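/- Let $G=\prod_{j=0}^\infty Z_2$ be the Walsh group with its normalized Haar measure $\mu$, and let $\zeta_m$ be the $\sigma$-algebra generated by the dyadic intervals $I_m(x)=\{y\in G: y_0=x_0,\dots,y_{m-1}=x_{m-1}\}$. Let $w_k(x)=\prod_{j}(-1)^{k_jx_j}$ (where $k=\sum_j k_j2^j$, $k_j\in\{0,1\}$) be the Walsh functions. For a real martingale $F=(F_m)_{m\in\mathbb N}$ with respect to $(\zeta_m)$ put $F^*=\sup_{m}|F_m|$ and $\|F\|_{H_{1/2}}=\|F^*\|_{1/2}$, where $\|g\|_{1/2}=\left(\int_G|g|^{1/2}d\mu\right)^{2}$; $H_{1/2}(G)$ consists of the martingales with $\|F\|_{H_{1/2}}<\infty$. Put $$\widehat F(k)=\lim_{m\to\infty}\int_G F_m w_k\,d\mu,\qquad S_jF=\sum_{k=0}^{j-1}\widehat F(k)w_k,\qquad \sigma_jF=\frac1j\sum_{i=1}^{j}S_iF .$$ Let $n\ge 1$ be an integer. For $s\in\mathbb N$ and $0\le k\le[\sqrt[n]{s}]-1$ (where $[\cdot]$ denotes the integer part) let $$\alpha_k^s=2^s+2^0+2^1+\dots+2^k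 .$$ Then the restricted maximal operator $$\tilde\sigma_6^{*,\nabla}F:=\sup_{s\in\mathbb N}\ \sup_{0\le k\le[\sqrt[n]{s}]-1}\frac{|\sigma_{\alpha_k^s}F|}{\log^{2/n}\alpha_k^s}$$ (a supremum over no indices being $0$) is bounded from the Hardy space $H_{1/2}(G)$ to the Lebesgue space $L_{1/2}(G)$: there is a constant $c$, depending only on $n$, such that for every $F\in H_{1/2}(G)$ the function $\tilde\sigma_6^{*,\nabla}F$ belongs to $L_{1/2}(G)$ and $$\|\tilde\sigma_6^{*,\nabla}F\|_{1/2}\le c\,\|F\|_{H_{1/2}} .$$ In particular ($n=2$), for $0\le k\le[\sqrt s]-1$ the normalization $\log\alpha_k^s$ suffices. -/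

import Mathlib

open MeasureTheory ProbabilityTheory Filter Topology
open scoped ENNReal NNReal

noncomputable section

namespace WalshFejer

/-- The Walsh group `G`: the complete direct product of countably many copies of `Z_2`. -/
abbrev G : Type := ℕ → ZMod 2

/-- The Haar measure on `Z_2`: every singleton has measure `1/2`. -/
def z2Measure : Measure (ZMod 2) := (2 : ℝ≥0∞)⁻¹ • Measure.count

instance : IsProbabilityMeasure z2Measure := by
  constructor
  have h : (Measure.count (Set.univ : Set (ZMod 2)) : ℝ≥0∞) = 2 := by
    rw [Measure.count_univ]
    simp [ENat.card_eq_coe_fintype_card, ZMod.card]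
  rw [z2Measure, Measure.smul_apply, h, smul_eq_mul]
  exact ENNReal.inv_mul_cancel (by norm_num) (by norm_num)

/-- The normalized Haar measure `μ` on `G`: the product measure. -/
def haarG : Measure G := Measure.infinitePi (fun _ : ℕ => z2Measure)

instance : IsProbabilityMeasure haarG := by
  unfold haarG
  infer_instance

/-- The dyadic interval `I_n(x) = {y : y_0 = x_0, …, y_{n-1} = x_{n-1}}`. -/
def dyadicInterval (n : ℕ) (x : G) : Set G := {y | ∀ i < n, y i = x i}

theorem measurableSet_dyadicInterval (n : ℕ) (x : G) :
    MeasurableSet (dyadicInterval n x) := by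
  have h : dyadicInterval n x = ⋂ i : ℕ, ⋂ _ : i < n, (fun y : G => y i) ⁻¹' {x i} := by
    ext y
    simp [dyadicInterval]
  rw [h]
  exact MeasurableSet.iInter fun i => MeasurableSet.iInter fun _ =>
    (measurable_pi_apply i) (MeasurableSet.singleton _)

/-- The filtration `(ζ_n)`: `ζ_n` is the σ-algebra generated by the intervals `I_n(x)`, `x ∈ G`. -/
def dyadicFiltration : Filtration ℕ (inferInstance : MeasurableSpace G) where
  seq n := MeasurableSpace.generateFrom (Set.range (dyadicInterval n))
  mono' := by
    intro n m hnm
    refine MeasurableSpace.generateFrom_le ?_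
    rintro _ ⟨x, rfl⟩
    let ext : (Fin m → ZMod 2) → G := fun v i => if h : i < m then v ⟨i, h⟩ else 0
    have h : dyadicInterval n x =
        ⋃ v : Fin m → ZMod 2, ⋃ _ : ext v ∈ dyadicInterval n x, dyadicInterval m (ext v) := by
      ext y
      simp only [Set.mem_iUnion, exists_prop]
      constructor
      · intro hy
        refine ⟨fun i => y i, fun i hi => ?_, fun i hi => ?_⟩
        · simp only [ext, dif_pos (lt_of_lt_of_le hi hnm)]
          exact hy i hi
        · simp only [ext, dif_pos hi]
      · rintro ⟨v, hv, hy⟩ i hi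
        rw [hy i (lt_of_lt_of_le hi hnm), hv i hi]
    rw [h]
    exact MeasurableSet.iUnion fun v => MeasurableSet.iUnion fun _ =>
      MeasurableSpace.measurableSet_generateFrom ⟨_, rfl⟩
  le' := by
    intro n
    refine MeasurableSpace.generateFrom_le ?_
    rintro _ ⟨x, rfl⟩
    exact measurableSet_dyadicInterval n x

/-- The Rademacher function `r_k(x) = (-1)^{x_k}`. -/
def rademacher (k : ℕ) (x : G) : ℝ := (-1) ^ (x k).val

/-- The Walsh function `w_n(x) = ∏_k r_k(x)^{n_k}`, where `n_k` is the `k`-th binary digit of `n`.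
Since `n < 2 ^ n`, the digits `n_k` with `k ≥ n` vanish and the product is over `k < n`. -/
def walsh (n : ℕ) (x : G) : ℝ :=
  ∏ k ∈ Finset.range n, rademacher k x ^ (n.testBit k).toNat

/-- The maximal function `F^* = sup_n |F_n|`. -/
def maximalFunction (F : ℕ → G → ℝ) (x : G) : ℝ≥0∞ := ⨆ n, ‖F n x‖ₑ

/-- The Hardy quasi-norm `‖F‖_{H_p} = ‖F^*‖_p`. -/
def hardyNorm (p : ℝ≥0∞) (F : ℕ → G → ℝ) : ℝ≥0∞ := eLpNorm (maximalFunction F) p haarG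

/-- Membership in the martingale Hardy space `H_p(G)`. -/
def MemHardy (p : ℝ≥0∞) (F : ℕ → G → ℝ) : Prop :=
  Martingale F dyadicFiltration haarG ∧ hardyNorm p F < ∞

/-- The `k`-th Walsh–Fourier coefficient `lim_n ∫ F_n w_k dμ` of a martingale `F`
(for a martingale the sequence is eventually constant, so the limit exists). -/
def walshCoeff (F : ℕ → G → ℝ) (k : ℕ) : ℝ :=
  limUnder atTop (fun n => ∫ x, F n x * walsh k x ∂haarG)

/-- The partial sum `S_n F = ∑_{k<n} F̂(k) w_k` of the Walsh–Fourier series. -/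
def partialSum (n : ℕ) (F : ℕ → G → ℝ) (x : G) : ℝ :=
  ∑ k ∈ Finset.range n, walshCoeff F k * walsh k x

/-- The Fejér mean `σ_n F = (1/n) ∑_{k=1}^n S_k F`. -/
def fejerMean (n : ℕ) (F : ℕ → G → ℝ) (x : G) : ℝ :=
  (1 / (n : ℝ)) * ∑ k ∈ Finset.Icc 1 n, partialSum k F x

/-- The index `α_k^s = 2^s + 2^0 + 2^1 + ⋯ + 2^k`. -/
def alpha (s k : ℕ) : ℕ := 2 ^ s + ∑ j ∈ Finset.range (k + 1), 2 ^ j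

/-- The restricted weighted maximal operator
`sup_s sup_{0 ≤ k ≤ [s^{1/n}] - 1} |σ_{α_k^s} F| / log^{2/n} α_k^s`. -/
def restrictedMaximal (n : ℕ) (F : ℕ → G → ℝ) (x : G) : ℝ≥0∞ :=
  ⨆ (s : ℕ) (k : ℕ) (_ : k < ⌊(s : ℝ) ^ (1 / (n : ℝ))⌋₊),
    ENNReal.ofReal (|fejerMean (alpha s k) F x| / Real.log (alpha s k) ^ (2 / (n : ℝ)))

end WalshFejer

end

/-! The index is `2 ^ s + (2 ^ N - 1)` with `N = k + 1`, so the Fejér sum splits at `2 ^ s`. In a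
Walsh sum of dyadic length the Fejér weights are combinations of the signs by which coordinate flips
act on the Walsh functions (`sum_walshPoly_two_pow`). Hence the mean is bounded by `F s`, its flips
at `j < s` with weights `2 ^ (j - s)`, and analogous terms in `H_N`, the Walsh polynomial of length
`2 ^ N` of the coefficients shifted by `2 ^ s` (`abs_fejerMean_two_pow_add_le`). Square roots are
then taken termwise by subadditivity.

The increments of `max_{i ≤ m} |F_i| ^ (1/2)` are nonnegative, and their integrals add up to at most
the integral of `(F^*) ^ (1/2)`. Flipping coordinate `j` does not change the maximum up to time `j`,
so a translate costs only later increments, with geometric weights (`shiftedMaxSum_le`).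

`H_N` is an iterated coordinate average of `H_s`. The square root of an average is not controlled by
the average of square roots, but `H_N` carries the factor `2 ^ (N - s)`, whose root compensates one
factor `2 ^ (-1/2)` per averaging step (`le_of_sq_le_average`). What is left is the maximum up to
time `N` plus a remainder linear in the increments (`sqrt_le_add_remainder`), whose integral has a
bound independent of `N` and summable in `s`. Replacing the supremum over `N ≤ [s^{1/n}]` by a sum
costs a factor `[s^{1/n}]`, which the root of the weight, `log^{1/n}`, absorbs
(`half_rootFloor_le`). -/

noncomputable section

namespace WalshFejer

/-! ### Coordinate flips and coordinate averages -/

/-- The translation `x ↦ x + e_i`. -/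
def flip (i : ℕ) (x : G) : G := fun j => x j + if j = i then 1 else 0

theorem flip_apply_of_ne {i j : ℕ} (h : j ≠ i) (x : G) : flip i x j = x j := by
  simp [flip, h]

theorem measurable_flip (i : ℕ) : Measurable (flip i) := by
  unfold flip
  fun_prop

theorem flip_flip (i : ℕ) (x : G) : flip i (flip i x) = x := by
  funext j
  have h : (1 : ZMod 2) + 1 = 0 := by decide
  by_cases hj : j = i <;> simp [flip, hj, add_assoc, h]

theorem map_add_right_z2Measure (a : ZMod 2) : z2Measure.map (fun x => x + a) = z2Measure := by
  ext s hs
  have h : (fun x : ZMod 2 => x + a) ⁻¹' s = (Equiv.addRight a) ⁻¹' s := rfl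
  rw [Measure.map_apply (by fun_prop) hs, z2Measure, Measure.smul_apply, Measure.smul_apply, h,
    Measure.count_apply MeasurableSet.of_discrete, Measure.count_apply hs]
  congr 2
  exact_mod_cast Set.encard_preimage_of_bijective (Equiv.addRight a).bijective s

theorem measurePreserving_flip (i : ℕ) : MeasurePreserving (flip i) haarG haarG := by
  refine ⟨measurable_flip i, ?_⟩
  have h := Measure.infinitePi_map_pi (fun _ : ℕ => z2Measure)
    (f := fun j (y : ZMod 2) => y + if j = i then 1 else 0) (fun j => by fun_prop)
  unfold haarG
  refine h.trans ?_
  congr 1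
  funext j
  exact map_add_right_z2Measure _

/-- The average of a function over the `i`-th coordinate. -/
def coordAvg (i : ℕ) (f : G → ℝ) (x : G) : ℝ := (f x + f (flip i x)) / 2

theorem integral_comp_flip (i : ℕ) (f : G → ℝ) :
    ∫ x, f (flip i x) ∂haarG = ∫ x, f x ∂haarG := by
  refine (measurePreserving_flip i).integral_comp ?_ f
  exact (MeasurableEquiv.ofInvolutive (flip i) (flip_flip i) (measurable_flip i)).measurableEmbedding

theorem integrable_comp_flip (i : ℕ) {f : G → ℝ} (hf : Integrable f haarG) :
    Integrable (fun x => f (flip i x)) haarG :=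
  (measurePreserving_flip i).integrable_comp_of_integrable hf

theorem integrable_coordAvg (i : ℕ) {f : G → ℝ} (hf : Integrable f haarG) :
    Integrable (coordAvg i f) haarG :=
  (hf.add (integrable_comp_flip i hf)).div_const 2

theorem integral_coordAvg_mul (i : ℕ) {f g : G → ℝ} (hf : Integrable (fun x => f x * g x) haarG)
    (hg : ∀ x, g (flip i x) = g x) :
    ∫ x, coordAvg i f x * g x ∂haarG = ∫ x, f x * g x ∂haarG := by
  have h1 : (fun x => coordAvg i f x * g x) =
      fun x => (f x * g x) / 2 + (f (flip i x) * g (flip i x)) / 2 := by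
    funext x
    rw [hg, coordAvg]
    ring
  have h2 := integrable_comp_flip i hf
  rw [h1, integral_add (hf.div_const 2) (h2.div_const 2), integral_div, integral_div,
    integral_comp_flip i (fun x => f x * g x)]
  ring

theorem dependsOn_flip {β : Type*} {s i : ℕ} (h : s ≤ i) {f : G → β} (hf : DependsOn f (Set.Iio s))
    (x : G) : f (flip i x) = f x :=
  hf fun j hj => flip_apply_of_ne (by have : j < s := hj; omega) x

theorem dependsOn_comp_flip {β : Type*} {s i : ℕ} {f : G → β} (hf : DependsOn f (Set.Iio s)) :
    DependsOn (fun x => f (flip i x)) (Set.Iio s) := by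
  intro x y h
  refine hf fun j hj => ?_
  simp only [flip, h j hj]

/-- Since `ZMod 2` has two elements, points agreeing below `s` either agree at `s` or differ there
by exactly the flip. -/
theorem dependsOn_of_flip {β : Type*} {s : ℕ} {f : G → β} (hf : DependsOn f (Set.Iio (s + 1)))
    (h : ∀ x, f (flip s x) = f x) : DependsOn f (Set.Iio s) := by
  intro x y hxy
  by_cases hs : x s = y s
  · refine hf fun j hj => ?_
    rcases Nat.lt_succ_iff_lt_or_eq.mp hj with h' | rfl
    · exact hxy j h'
    · exact hs
  · rw [← h x]
    refine hf fun j hj => ?_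
    rcases Nat.lt_succ_iff_lt_or_eq.mp hj with h' | rfl
    · rw [flip_apply_of_ne h'.ne]
      exact hxy j h'
    · have key : ∀ a b : ZMod 2, a ≠ b → a + 1 = b := by decide
      simpa [flip] using key _ _ hs

theorem dependsOn_coordAvg {s : ℕ} {f : G → ℝ} (hf : DependsOn f (Set.Iio (s + 1))) :
    DependsOn (coordAvg s f) (Set.Iio s) := by
  refine dependsOn_of_flip (fun x y h => ?_) fun x => ?_
  · have h1 : f (flip s x) = f (flip s y) := dependsOn_comp_flip hf h
    rw [coordAvg, coordAvg, hf h, h1]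
  · rw [coordAvg, coordAvg, flip_flip, add_comm]

/-! ### Dyadic martingales as coordinate averages -/

theorem haarG_dyadicInterval_pos (s : ℕ) (x : G) : 0 < haarG (dyadicInterval s x) := by
  have h : dyadicInterval s x = Set.pi (Finset.range s) (fun i => {x i}) := by
    ext y
    simp [dyadicInterval, Set.mem_pi]
  rw [h, haarG, Measure.infinitePi_pi _ (fun i _ => MeasurableSet.singleton _)]
  simp [z2Measure, Finset.prod_const, ENNReal.pow_pos]

theorem mem_iff_of_measurableSet_dyadicFiltration {s : ℕ} {A : Set G}
    (hA : MeasurableSet[dyadicFiltration s] A) {x y : G} (hxy : ∀ i < s, x i = y i) :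
    x ∈ A ↔ y ∈ A := by
  induction A, hA using MeasurableSpace.generateFrom_induction with
  | hC A hA _ =>
    obtain ⟨z, rfl⟩ := hA
    exact forall₂_congr fun i hi => by rw [hxy i hi]
  | empty => simp
  | compl A _ ih => simp [ih]
  | iUnion A _ ih => simp [ih]

theorem dependsOn_of_stronglyMeasurable {s : ℕ} {f : G → ℝ}
    (hf : StronglyMeasurable[dyadicFiltration s] f) : DependsOn f (Set.Iio s) := by
  intro x y hxy
  have h : MeasurableSet[dyadicFiltration s] (f ⁻¹' {f y}) :=
    hf.measurable (MeasurableSet.singleton _)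
  exact (mem_iff_of_measurableSet_dyadicFiltration h hxy).mpr rfl

/-- Both sides are constant on `dyadicInterval s x`, which has positive measure and is invariant
under `flip s`, so comparing integrals over it suffices. The identity holds everywhere, not just
almost everywhere. -/
theorem martingale_eq_coordAvg {F : ℕ → G → ℝ} (hF : Martingale F dyadicFiltration haarG)
    (s : ℕ) : F s = coordAvg s (F (s + 1)) := by
  funext x
  have hI : MeasurableSet[dyadicFiltration s] (dyadicInterval s x) :=
    MeasurableSpace.measurableSet_generateFrom ⟨x, rfl⟩
  have hI' := measurableSet_dyadicInterval s x
  have h1 := hF.setIntegral_eq (Nat.le_succ s) hI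
  have hd : DependsOn (F s) (Set.Iio s) := dependsOn_of_stronglyMeasurable (hF.stronglyAdapted s)
  have hd' : DependsOn (F (s + 1)) (Set.Iio (s + 1)) :=
    dependsOn_of_stronglyMeasurable (hF.stronglyAdapted (s + 1))
  have hconst : ∀ g : G → ℝ, DependsOn g (Set.Iio s) →
      ∫ y in dyadicInterval s x, g y ∂haarG = haarG.real (dyadicInterval s x) * g x := by
    intro g hg
    rw [setIntegral_congr_fun hI' (g := fun _ => g x) fun y hy => hg hy]
    simp
  have hflip : ∀ y, (dyadicInterval s x).indicator (1 : G → ℝ) (flip s y) =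
      (dyadicInterval s x).indicator 1 y := by
    intro y
    have : flip s y ∈ dyadicInterval s x ↔ y ∈ dyadicInterval s x :=
      forall₂_congr fun i hi => by rw [flip_apply_of_ne hi.ne]
    by_cases hy : y ∈ dyadicInterval s x <;> simp [hy, this]
  have hmul : ∀ g : G → ℝ, (fun y => g y * (dyadicInterval s x).indicator 1 y) =
      (dyadicInterval s x).indicator g := by
    intro g
    funext y
    by_cases hy : y ∈ dyadicInterval s x <;> simp [hy]
  have h2 := integral_coordAvg_mul s (f := F (s + 1)) (by
    rw [hmul]; exact (hF.integrable _).indicator hI') hflip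
  rw [hmul, hmul, integral_indicator hI', integral_indicator hI', hconst _ (dependsOn_coordAvg hd')] at h2
  rw [hconst _ hd, Nat.succ_eq_add_one, ← h2] at h1
  have hpos : haarG.real (dyadicInterval s x) ≠ 0 :=
    (ENNReal.toReal_pos (haarG_dyadicInterval_pos s x).ne' (measure_ne_top _ _)).ne'
  exact mul_left_cancel₀ hpos h1

/-! ### Walsh functions and Walsh expansions -/

theorem measurable_rademacher (k : ℕ) : Measurable (rademacher k) := by
  unfold rademacher
  exact (measurable_of_finite (fun a : ZMod 2 => ((-1 : ℝ)) ^ a.val)).comp (measurable_pi_apply k)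

theorem rademacher_flip_self (k : ℕ) (x : G) : rademacher k (flip k x) = -rademacher k x := by
  have key : ∀ a : ZMod 2, ((-1 : ℝ)) ^ (a + 1).val = -(-1) ^ a.val := by
    intro a
    have h0 : ((0 : ZMod 2) + 1).val = 1 := rfl
    have h1 : ((1 : ZMod 2) + 1).val = 0 := rfl
    have h2 : (1 : ZMod 2).val = 1 := rfl
    rcases (by decide : ∀ a : ZMod 2, a = 0 ∨ a = 1) a with rfl | rfl
    · simp [h2]
    · simp [h1, h2]
  simpa [rademacher, flip] using key (x k)

theorem rademacher_flip_of_ne {i k : ℕ} (h : k ≠ i) (x : G) :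
    rademacher k (flip i x) = rademacher k x := by
  rw [rademacher, rademacher, flip_apply_of_ne h]

theorem rademacher_mul_self (k : ℕ) (x : G) : rademacher k x * rademacher k x = 1 := by
  rw [rademacher, ← mul_pow]
  simp

theorem measurable_walsh (n : ℕ) : Measurable (walsh n) := by
  unfold walsh
  exact Finset.measurable_fun_prod _ fun k _ => (measurable_rademacher k).pow_const _

theorem walsh_eq_prod {n M : ℕ} (h : n < 2 ^ M) (x : G) :
    walsh n x = ∏ k ∈ Finset.range M, rademacher k x ^ (n.testBit k).toNat := by
  have aux : ∀ {A B : ℕ}, A ≤ B → n < 2 ^ A →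
      ∏ k ∈ Finset.range A, rademacher k x ^ (n.testBit k).toNat =
      ∏ k ∈ Finset.range B, rademacher k x ^ (n.testBit k).toNat := by
    intro A B hAB hA
    refine Finset.prod_subset (Finset.range_mono hAB) fun k _ hk => ?_
    have hk' : A ≤ k := by simpa using hk
    rw [Nat.testBit_lt_two_pow (hA.trans_le (Nat.pow_le_pow_right (by norm_num) hk'))]
    simp
  rw [walsh]
  rcases le_total n M with hM | hM
  · exact aux hM n.lt_two_pow_self
  · exact (aux hM h).symm

theorem walsh_zero (x : G) : walsh 0 x = 1 := by simp [walsh]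

theorem walsh_two_pow_add {s k : ℕ} (h : k < 2 ^ s) (x : G) :
    walsh (2 ^ s + k) x = rademacher s x * walsh k x := by
  rw [walsh_eq_prod (M := s + 1) (by rw [pow_succ]; omega), walsh_eq_prod h,
    Finset.prod_range_succ, Nat.testBit_two_pow_add_eq, Nat.testBit_lt_two_pow h, mul_comm]
  congr 1
  · simp
  · refine Finset.prod_congr rfl fun j hj => ?_
    rw [Nat.testBit_two_pow_add_gt (Finset.mem_range.mp hj)]

theorem walsh_flip (k j : ℕ) (x : G) :
    walsh k (flip j x) = (if k.testBit j then -1 else 1) * walsh k x := by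
  set M := k + j + 1 with hM
  have hk : k < 2 ^ M := (Nat.lt_two_pow_self).trans_le (Nat.pow_le_pow_right (by norm_num) (by omega))
  have hj : j ∈ Finset.range M := by simp [hM]
  rw [walsh_eq_prod hk, walsh_eq_prod hk, ← Finset.mul_prod_erase _ _ hj,
    ← Finset.mul_prod_erase _ _ hj, rademacher_flip_self, ← mul_assoc]
  congr 1
  · cases k.testBit j <;> simp
  · refine Finset.prod_congr rfl fun i hi => ?_
    rw [rademacher_flip_of_ne (Finset.ne_of_mem_erase hi)]

theorem walsh_flip_of_lt {k j : ℕ} (h : k < 2 ^ j) (x : G) : walsh k (flip j x) = walsh k x := by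
  rw [walsh_flip, Nat.testBit_lt_two_pow h]
  simp

theorem abs_rademacher (k : ℕ) (x : G) : |rademacher k x| = 1 := by
  simp [rademacher, abs_pow]

theorem abs_walsh (n : ℕ) (x : G) : |walsh n x| = 1 := by
  simp [walsh, Finset.abs_prod, abs_pow, abs_rademacher]

theorem integrable_mul_walsh {f : G → ℝ} (hf : Integrable f haarG) (k : ℕ) :
    Integrable (fun x => f x * walsh k x) haarG :=
  hf.mul_bdd (c := 1) (measurable_walsh k).aestronglyMeasurable
    (Eventually.of_forall fun x => by simp [abs_walsh])

theorem integrable_mul_rademacher {f : G → ℝ} (hf : Integrable f haarG) (k : ℕ) :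
    Integrable (fun x => f x * rademacher k x) haarG :=
  hf.mul_bdd (c := 1) (measurable_rademacher k).aestronglyMeasurable
    (Eventually.of_forall fun x => by simp [abs_rademacher])

/-- Split `f` into its even and odd parts in the last coordinate. The odd part is `rademacher s`
times the average of `f * rademacher s`; the two parts supply the lower and upper halves of the
frequencies. -/
theorem walsh_expansion (s : ℕ) {f : G → ℝ} (hf : Integrable f haarG)
    (hd : DependsOn f (Set.Iio s)) (x : G) :
    f x = ∑ k ∈ Finset.range (2 ^ s), (∫ y, f y * walsh k y ∂haarG) * walsh k x := by
  induction s generalizing f with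
  | zero =>
    have h : ∀ y, f y = f x := fun y => hd fun i hi => by simp at hi
    simp only [pow_zero, Finset.range_one, Finset.sum_singleton, walsh_zero, mul_one]
    rw [integral_congr_ae (Eventually.of_forall h)]
    simp
  | succ s ih =>
    set g : G → ℝ := fun y => f y * rademacher s y with hg
    have hgi : Integrable g haarG := integrable_mul_rademacher hf s
    have hgd : DependsOn g (Set.Iio (s + 1)) := by
      intro y z hyz
      simp only [hg]
      rw [hd hyz, rademacher, rademacher, hyz s (Nat.lt_succ_self s)]
    have h1 := ih (integrable_coordAvg s hf) (dependsOn_coordAvg hd)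
    have h2 := ih (integrable_coordAvg s hgi) (dependsOn_coordAvg hgd)
    have hdec : f x = coordAvg s f x + rademacher s x * coordAvg s g x := by
      simp only [coordAvg, hg, rademacher_flip_self]
      linear_combination (-(f x - f (flip s x)) / 2) * rademacher_mul_self s x
    rw [pow_succ, mul_two, Finset.sum_range_add, hdec, h1, h2, Finset.mul_sum]
    congr 1
    · refine Finset.sum_congr rfl fun k hk => ?_
      rw [integral_coordAvg_mul s (integrable_mul_walsh hf k)
        (walsh_flip_of_lt (Finset.mem_range.mp hk))]
    · refine Finset.sum_congr rfl fun k hk => ?_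
      have hk' := Finset.mem_range.mp hk
      rw [integral_coordAvg_mul s (integrable_mul_walsh hgi k) (walsh_flip_of_lt hk'),
        walsh_two_pow_add hk']
      simp only [walsh_two_pow_add hk', hg, mul_assoc]
      ring

theorem walshCoeff_eq {F : ℕ → G → ℝ} (hF : Martingale F dyadicFiltration haarG) {s k : ℕ}
    (hk : k < 2 ^ s) : walshCoeff F k = ∫ x, F s x * walsh k x ∂haarG := by
  have h : ∀ n, s ≤ n → ∫ x, F n x * walsh k x ∂haarG = ∫ x, F s x * walsh k x ∂haarG := by
    intro n hn
    induction n, hn using Nat.le_induction with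
    | base => rfl
    | succ n hn ih =>
      rw [← ih, ← integral_coordAvg_mul n (integrable_mul_walsh (hF.integrable _) k)
        (walsh_flip_of_lt (hk.trans_le (Nat.pow_le_pow_right (by norm_num) hn))),
        ← martingale_eq_coordAvg hF]
  exact (tendsto_atTop_of_eventually_const h).limUnder_eq

theorem partialSum_two_pow {F : ℕ → G → ℝ} (hF : Martingale F dyadicFiltration haarG) (s : ℕ)
    (x : G) : partialSum (2 ^ s) F x = F s x := by
  rw [walsh_expansion s (hF.integrable s) (dependsOn_of_stronglyMeasurable (hF.stronglyAdapted s)) x,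
    partialSum]
  refine Finset.sum_congr rfl fun k hk => ?_
  rw [walshCoeff_eq hF (Finset.mem_range.mp hk)]

/-! ### Fejér sums through coordinate flips -/

/-- The Walsh polynomial of length `n` with coefficients `c`. -/
def walshPoly (c : ℕ → ℝ) (n : ℕ) (x : G) : ℝ := ∑ k ∈ Finset.range n, c k * walsh k x

theorem sum_Icc_sum_range (u : ℕ → ℝ) (M : ℕ) :
    ∑ i ∈ Finset.Icc 1 M, ∑ k ∈ Finset.range i, u k =
      ∑ k ∈ Finset.range M, ((M : ℝ) - k) * u k := by
  induction M with
  | zero => simp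
  | succ M ih =>
    rw [Finset.sum_Icc_succ_top (by omega), ih, Finset.sum_range_succ (fun k => u k),
      Finset.sum_range_succ, ← add_assoc, ← Finset.sum_add_distrib]
    push_cast
    congr 1
    · exact Finset.sum_congr rfl fun k _ => by ring
    · ring

/-- Each sign is `1 - 2 * k_j`, with `k_j` the binary digit. -/
theorem sum_two_pow_testBit (k N : ℕ) :
    ∑ j ∈ Finset.range N, (2 : ℝ) ^ j * (if k.testBit j then -1 else 1) =
      2 ^ N - 1 - 2 * (k % 2 ^ N : ℕ) := by
  induction N with
  | zero => simp [Nat.mod_one]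
  | succ N ih =>
    rw [Finset.sum_range_succ, ih, Nat.mod_pow_succ, Nat.testBit_eq_decide_div_mod_eq]
    rcases Nat.mod_two_eq_zero_or_one (k / 2 ^ N) with h | h <;> simp [h] <;> ring

/-- The coefficient at `k` receives weight `2 ^ N - k`. By `sum_two_pow_testBit` this is half of `1
+ 2 ^ N` plus the signed sum of the `2 ^ j`, and each sign is the eigenvalue of `walsh k` under
`flip j`. -/
theorem sum_walshPoly_two_pow (c : ℕ → ℝ) (N : ℕ) (x : G) :
    ∑ i ∈ Finset.Icc 1 (2 ^ N), walshPoly c i x =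
      (walshPoly c (2 ^ N) x + 2 ^ N * walshPoly c (2 ^ N) x +
        ∑ j ∈ Finset.range N, 2 ^ j * walshPoly c (2 ^ N) (flip j x)) / 2 := by
  have h : ∀ k ∈ Finset.range (2 ^ N), (((2 ^ N : ℕ) : ℝ) - k) * (c k * walsh k x) =
      (c k * walsh k x + 2 ^ N * (c k * walsh k x) +
        ∑ j ∈ Finset.range N, 2 ^ j * (c k * walsh k (flip j x))) / 2 := by
    intro k hk
    have h1 := sum_two_pow_testBit k N
    rw [Nat.mod_eq_of_lt (Finset.mem_range.mp hk)] at h1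
    have h2 : ∑ j ∈ Finset.range N, (2 : ℝ) ^ j * (c k * walsh k (flip j x)) =
        (∑ j ∈ Finset.range N, (2 : ℝ) ^ j * (if k.testBit j then -1 else 1)) *
          (c k * walsh k x) := by
      rw [Finset.sum_mul]
      refine Finset.sum_congr rfl fun j _ => ?_
      rw [walsh_flip]
      ring
    rw [h2, h1]
    push_cast
    ring
  simp only [walshPoly]
  rw [sum_Icc_sum_range, Finset.sum_congr rfl h, ← Finset.sum_div, Finset.sum_add_distrib,
    Finset.sum_add_distrib, Finset.sum_comm]
  simp only [Finset.mul_sum]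

/-- Frequencies in the upper half are odd in coordinate `N` and cancel. -/
theorem coordAvg_walshPoly_two_pow (c : ℕ → ℝ) (N : ℕ) :
    coordAvg N (walshPoly c (2 ^ (N + 1))) = walshPoly c (2 ^ N) := by
  funext x
  have h1 : walshPoly c (2 ^ N) (flip N x) = walshPoly c (2 ^ N) x :=
    Finset.sum_congr rfl fun k hk => by rw [walsh_flip_of_lt (Finset.mem_range.mp hk)]
  simp only [walshPoly] at h1
  have h2 : ∑ k ∈ Finset.range (2 ^ N), c (2 ^ N + k) * walsh (2 ^ N + k) (flip N x) =
      -∑ k ∈ Finset.range (2 ^ N), c (2 ^ N + k) * walsh (2 ^ N + k) x := by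
    rw [← Finset.sum_neg_distrib]
    refine Finset.sum_congr rfl fun k hk => ?_
    have hk' := Finset.mem_range.mp hk
    rw [walsh_two_pow_add hk', walsh_two_pow_add hk', walsh_flip_of_lt hk', rademacher_flip_self]
    ring
  simp only [coordAvg, walshPoly]
  rw [pow_succ, mul_two, Finset.sum_range_add, Finset.sum_range_add, h1, h2]
  ring

/-- The Walsh coefficients of `F` from the index `2 ^ s` on. -/
def shiftedCoeff (F : ℕ → G → ℝ) (s k : ℕ) : ℝ := walshCoeff F (2 ^ s + k)

theorem partialSum_two_pow_add (F : ℕ → G → ℝ) {s i : ℕ} (hi : i ≤ 2 ^ s) (x : G) :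
    partialSum (2 ^ s + i) F x =
      partialSum (2 ^ s) F x + rademacher s x * walshPoly (shiftedCoeff F s) i x := by
  rw [partialSum, Finset.sum_range_add, walshPoly, Finset.mul_sum, partialSum]
  congr 1
  refine Finset.sum_congr rfl fun k hk => ?_
  rw [walsh_two_pow_add ((Finset.mem_range.mp hk).trans_le hi), shiftedCoeff]
  ring

/-- Up to the sign `rademacher s`, the polynomial is the martingale difference `F (s + 1) - F s`,
which is half the difference of `F (s + 1)` at `x` and at its flip. -/
theorem abs_walshPoly_shiftedCoeff_le {F : ℕ → G → ℝ}
    (hF : Martingale F dyadicFiltration haarG) (s : ℕ) (x : G) :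
    |walshPoly (shiftedCoeff F s) (2 ^ s) x| ≤
      (|F (s + 1) x| + |F (s + 1) (flip s x)|) / 2 := by
  have h := partialSum_two_pow_add F (le_refl (2 ^ s)) x
  rw [← two_mul, ← pow_succ', partialSum_two_pow hF, partialSum_two_pow hF,
    martingale_eq_coordAvg hF s, coordAvg] at h
  have h' : |walshPoly (shiftedCoeff F s) (2 ^ s) x| =
      |(F (s + 1) x - F (s + 1) (flip s x)) / 2| := by
    rw [← one_mul |walshPoly _ _ _|, ← abs_rademacher s x, ← abs_mul]
    congr 1
    linarith
  rw [h', abs_div, abs_two]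
  gcongr
  exact abs_sub _ _

theorem fejerMean_two_pow_add {F : ℕ → G → ℝ} (hF : Martingale F dyadicFiltration haarG)
    {s N m : ℕ} (hN : N ≤ s) (hm : m + 1 = 2 ^ N) (x : G) :
    ((2 ^ s + m : ℕ) : ℝ) * fejerMean (2 ^ s + m) F x =
      (F s x + 2 ^ s * F s x + ∑ j ∈ Finset.range s, 2 ^ j * F s (flip j x)) / 2 + m * F s x +
      rademacher s x * ((walshPoly (shiftedCoeff F s) (2 ^ N) x +
        2 ^ N * walshPoly (shiftedCoeff F s) (2 ^ N) x +
        ∑ j ∈ Finset.range N, 2 ^ j * walshPoly (shiftedCoeff F s) (2 ^ N) (flip j x)) / 2 -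
        walshPoly (shiftedCoeff F s) (2 ^ N) x) := by
  have hpos : ((2 ^ s + m : ℕ) : ℝ) ≠ 0 := by positivity
  have hle : 2 ^ N ≤ 2 ^ s := Nat.pow_le_pow_right (by norm_num) hN
  have hsplit : ∀ u : ℕ → ℝ, ∑ k ∈ Finset.Icc 1 (2 ^ s + m), u k =
      ∑ k ∈ Finset.Icc 1 (2 ^ s), u k + ∑ i ∈ Finset.Icc 1 m, u (2 ^ s + i) := by
    intro u
    clear hm
    induction m with
    | zero => simp
    | succ m ih =>
      rw [← add_assoc, Finset.sum_Icc_succ_top (Nat.le_add_left 1 _),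
        Finset.sum_Icc_succ_top (Nat.le_add_left 1 _), ih (by positivity), add_assoc, ← add_assoc (2 ^ s)]
  have h1 : ∑ k ∈ Finset.Icc 1 (2 ^ s), partialSum k F x =
      (F s x + 2 ^ s * F s x + ∑ j ∈ Finset.range s, 2 ^ j * F s (flip j x)) / 2 := by
    simp only [← partialSum_two_pow hF s]
    exact sum_walshPoly_two_pow (walshCoeff F) s x
  have h2 : ∑ i ∈ Finset.Icc 1 m, partialSum (2 ^ s + i) F x = m * F s x +
      rademacher s x * ∑ i ∈ Finset.Icc 1 m, walshPoly (shiftedCoeff F s) i x := by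
    rw [Finset.mul_sum]
    have : ∀ i ∈ Finset.Icc 1 m, partialSum (2 ^ s + i) F x =
        F s x + rademacher s x * walshPoly (shiftedCoeff F s) i x := by
      intro i hi
      have := (Finset.mem_Icc.mp hi).2
      rw [partialSum_two_pow_add F (by omega), partialSum_two_pow hF]
    rw [Finset.sum_congr rfl this, Finset.sum_add_distrib]
    simp
  have h3 := sum_walshPoly_two_pow (shiftedCoeff F s) N x
  -- The dyadic formula sums up to `m + 1`; its last term must be removed to stop at `m`.
  rw [← hm, Finset.sum_Icc_succ_top (by omega), hm] at h3
  rw [fejerMean, ← mul_assoc, mul_one_div_cancel hpos, one_mul, hsplit, h1, h2, ← h3]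
  ring

theorem abs_fejerMean_two_pow_add_le {F : ℕ → G → ℝ}
    (hF : Martingale F dyadicFiltration haarG)
    {s N m : ℕ} (hN : N ≤ s) (hm : m + 1 = 2 ^ N) (x : G) :
    2 ^ s * |fejerMean (2 ^ s + m) F x| ≤
      4 * 2 ^ s * |F s x| + ∑ j ∈ Finset.range s, 2 ^ j * |F s (flip j x)| +
      (2 ^ N * |walshPoly (shiftedCoeff F s) (2 ^ N) x| +
        ∑ j ∈ Finset.range N, 2 ^ j * |walshPoly (shiftedCoeff F s) (2 ^ N) (flip j x)|) := by
  set H := walshPoly (shiftedCoeff F s) (2 ^ N) with hH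
  have key := fejerMean_two_pow_add hF hN hm x
  have hsum : ∀ (n : ℕ) (g : G → ℝ), |∑ j ∈ Finset.range n, 2 ^ j * g (flip j x)| ≤
      ∑ j ∈ Finset.range n, 2 ^ j * |g (flip j x)| := by
    intro n g
    refine (Finset.abs_sum_le_sum_abs _ _).trans_eq (Finset.sum_congr rfl fun j _ => ?_)
    rw [abs_mul, abs_of_pos (by positivity : (0 : ℝ) < 2 ^ j)]
  have hm' : (m : ℝ) = 2 ^ N - 1 := by
    rw [eq_sub_iff_add_eq]
    exact_mod_cast hm
  have hNs : (2 : ℝ) ^ N ≤ 2 ^ s := pow_le_pow_right₀ (by norm_num) hN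
  have h1 : (1 : ℝ) ≤ 2 ^ N := one_le_pow₀ (by norm_num)
  have hl : 2 ^ s * |fejerMean (2 ^ s + m) F x| ≤
      |((2 ^ s + m : ℕ) : ℝ) * fejerMean (2 ^ s + m) F x| := by
    rw [abs_mul, Nat.abs_cast]
    gcongr
    push_cast
    linarith [Nat.cast_nonneg (α := ℝ) m]
  refine hl.trans ?_
  rw [key]
  have e1 : (F s x + 2 ^ s * F s x + ∑ j ∈ Finset.range s, 2 ^ j * F s (flip j x)) / 2 +
      m * F s x = ((1 + 2 ^ s) / 2 + m) * F s x +
        (∑ j ∈ Finset.range s, 2 ^ j * F s (flip j x)) / 2 := by ring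
  have e2 : (H x + 2 ^ N * H x + ∑ j ∈ Finset.range N, 2 ^ j * H (flip j x)) / 2 - H x =
      (2 ^ N - 1) / 2 * H x + (∑ j ∈ Finset.range N, 2 ^ j * H (flip j x)) / 2 := by ring
  rw [e1, e2]
  refine (abs_add_le _ _).trans (add_le_add ((abs_add_le _ _).trans (add_le_add ?_ ?_)) ?_)
  -- The constant `4` is not sharp; it is a perfect square, convenient when roots are taken.
  · rw [abs_mul, abs_of_nonneg (by positivity)]
    gcongr
    linarith
  · rw [abs_div, abs_two]
    exact (half_le_self (abs_nonneg _)).trans (hsum s (F s))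
  · rw [abs_mul, abs_rademacher, one_mul]
    refine (abs_add_le _ _).trans (add_le_add ?_ ?_)
    · rw [abs_mul, abs_of_nonneg (by linarith)]
      gcongr
      linarith
    · rw [abs_div, abs_two]
      exact (half_le_self (abs_nonneg _)).trans (hsum N H)

/-! ### Square roots of the pointwise bound -/

theorem nnrealSqrt_add_le (a b : ℝ≥0) : NNReal.sqrt (a + b) ≤ NNReal.sqrt a + NNReal.sqrt b := by
  rw [NNReal.sqrt_le_iff_le_sq, add_sq, NNReal.sq_sqrt, NNReal.sq_sqrt, add_right_comm]
  exact le_self_add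

theorem nnrealSqrt_sum_le (s : Finset ℕ) (f : ℕ → ℝ≥0) :
    NNReal.sqrt (∑ i ∈ s, f i) ≤ ∑ i ∈ s, NNReal.sqrt (f i) := by
  induction s using Finset.cons_induction with
  | empty => simp
  | cons a s ha ih =>
    rw [Finset.sum_cons, Finset.sum_cons]
    exact (nnrealSqrt_add_le _ _).trans (by gcongr)

/-- The ratio `2 ^ (-1/2)`. -/
def invSqrtTwo : ℝ≥0 := NNReal.sqrt (1 / 2)

theorem invSqrtTwo_sq : invSqrtTwo ^ 2 = 1 / 2 := NNReal.sq_sqrt _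

theorem invSqrtTwo_lt_one : invSqrtTwo < 1 := by
  refine lt_of_pow_lt_pow_left₀ 2 zero_le_one ?_
  rw [invSqrtTwo_sq, one_pow, ← NNReal.coe_lt_coe]
  norm_num

theorem one_le_two_mul_invSqrtTwo : 1 ≤ 2 * invSqrtTwo := by
  have h := invSqrtTwo_sq
  have h' : (invSqrtTwo : ℝ) ^ 2 = 1 / 2 := by
    rw [← NNReal.coe_pow, h]
    norm_num
  have : (1 : ℝ) ≤ 2 * invSqrtTwo := by nlinarith [invSqrtTwo.coe_nonneg]
  exact_mod_cast this

theorem nnrealSqrt_half_pow_mul (n : ℕ) (a : ℝ≥0) :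
    NNReal.sqrt ((1 / 2) ^ n * a) = invSqrtTwo ^ n * NNReal.sqrt a := by
  rw [NNReal.sqrt_mul, ← invSqrtTwo_sq, ← pow_mul, mul_comm 2 n, pow_mul, NNReal.sqrt_sq]

/-- The square root of the absolute value, as a nonnegative real number. -/
def sqrtAbs (a : ℝ) : ℝ≥0 := NNReal.sqrt ‖a‖₊

theorem sqrtAbs_fejerMean_le {F : ℕ → G → ℝ} (hF : Martingale F dyadicFiltration haarG)
    {s N m : ℕ} (hN : N ≤ s) (hm : m + 1 = 2 ^ N) (x : G) :
    sqrtAbs (fejerMean (2 ^ s + m) F x) ≤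
      2 * sqrtAbs (F s x) +
        ∑ j ∈ Finset.range s, invSqrtTwo ^ (s - j) * sqrtAbs (F s (flip j x)) +
      (invSqrtTwo ^ (s - N) * sqrtAbs (walshPoly (shiftedCoeff F s) (2 ^ N) x) +
        ∑ j ∈ Finset.range N, invSqrtTwo ^ (s - j) *
          sqrtAbs (walshPoly (shiftedCoeff F s) (2 ^ N) (flip j x))) := by
  set H := walshPoly (shiftedCoeff F s) (2 ^ N) with hH
  have h0 : ∀ j ≤ s, (2 : ℝ) ^ j = 2 ^ s * (1 / 2) ^ (s - j) := by
    intro j hj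
    obtain ⟨d, rfl⟩ := Nat.exists_eq_add_of_le hj
    rw [Nat.add_sub_cancel_left, pow_add, mul_assoc, ← mul_pow]
    norm_num
  have h1 : |fejerMean (2 ^ s + m) F x| ≤
      4 * |F s x| + ∑ j ∈ Finset.range s, (1 / 2) ^ (s - j) * |F s (flip j x)| +
      ((1 / 2) ^ (s - N) * |H x| +
        ∑ j ∈ Finset.range N, (1 / 2) ^ (s - j) * |H (flip j x)|) := by
    have h := abs_fejerMean_two_pow_add_le hF hN hm x
    refine le_of_mul_le_mul_left (h.trans_eq ?_) (by positivity : (0 : ℝ) < 2 ^ s)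
    rw [mul_add, mul_add, mul_add, Finset.mul_sum, Finset.mul_sum, h0 N hN, ← mul_assoc,
      ← mul_assoc, mul_comm 4]
    congr 1
    · congr 1
      refine Finset.sum_congr rfl fun j hj => ?_
      rw [h0 j (Finset.mem_range.mp hj).le, mul_assoc]
    · congr 1
      refine Finset.sum_congr rfl fun j hj => ?_
      rw [h0 j ((Finset.mem_range.mp hj).le.trans hN), mul_assoc]
  have h2 : ‖fejerMean (2 ^ s + m) F x‖₊ ≤
      4 * ‖F s x‖₊ + ∑ j ∈ Finset.range s, (1 / 2) ^ (s - j) * ‖F s (flip j x)‖₊ +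
      ((1 / 2) ^ (s - N) * ‖H x‖₊ +
        ∑ j ∈ Finset.range N, (1 / 2) ^ (s - j) * ‖H (flip j x)‖₊) := by
    rw [← NNReal.coe_le_coe]
    push_cast
    simpa only [Real.norm_eq_abs] using h1
  refine (NNReal.sqrt_le_sqrt.mpr h2).trans ?_
  refine (nnrealSqrt_add_le _ _).trans (add_le_add ((nnrealSqrt_add_le _ _).trans
    (add_le_add (le_of_eq ?_) ?_)) ((nnrealSqrt_add_le _ _).trans (add_le_add (le_of_eq ?_) ?_)))
  · rw [NNReal.sqrt_mul, show (4 : ℝ≥0) = 2 ^ 2 by norm_num, NNReal.sqrt_sq]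
    rfl
  · exact (nnrealSqrt_sum_le _ _).trans_eq
      (Finset.sum_congr rfl fun j _ => nnrealSqrt_half_pow_mul _ _)
  · exact nnrealSqrt_half_pow_mul _ _
  · exact (nnrealSqrt_sum_le _ _).trans_eq
      (Finset.sum_congr rfl fun j _ => nnrealSqrt_half_pow_mul _ _)

/-! ### The running maximum and its increments -/

/-- The maximal function `max_{i ≤ m} |F_i| ^ (1/2)`. -/
def sqrtMax (F : ℕ → G → ℝ) : ℕ → G → ℝ≥0
  | 0, x => sqrtAbs (F 0 x)
  | m + 1, x => max (sqrtMax F m x) (sqrtAbs (F (m + 1) x))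

/-- The increment of `sqrtMax` from `m` to `m + 1`. -/
def sqrtMaxIncr (F : ℕ → G → ℝ) (m : ℕ) (x : G) : ℝ≥0 := sqrtMax F (m + 1) x - sqrtMax F m x

theorem sqrtMax_succ (F : ℕ → G → ℝ) (m : ℕ) (x : G) :
    sqrtMax F (m + 1) x = sqrtMax F m x + sqrtMaxIncr F m x :=
  (add_tsub_cancel_of_le (le_max_left _ _)).symm

theorem sqrtMax_eq_add_sum (F : ℕ → G → ℝ) {j s : ℕ} (h : j ≤ s) (x : G) :
    sqrtMax F s x = sqrtMax F j x + ∑ m ∈ Finset.Ico j s, sqrtMaxIncr F m x := by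
  induction s, h using Nat.le_induction with
  | base => simp
  | succ s hs ih => rw [sqrtMax_succ, ih, Finset.sum_Ico_succ_top hs, add_assoc]

theorem sqrtMax_mono (F : ℕ → G → ℝ) {j s : ℕ} (h : j ≤ s) (x : G) :
    sqrtMax F j x ≤ sqrtMax F s x := by
  rw [sqrtMax_eq_add_sum F h]
  exact le_self_add

theorem sqrtAbs_le_sqrtMax (F : ℕ → G → ℝ) (m : ℕ) (x : G) :
    sqrtAbs (F m x) ≤ sqrtMax F m x := by
  cases m with
  | zero => exact le_rfl
  | succ m => exact le_max_right _ _

theorem measurable_sqrtAbs : Measurable sqrtAbs := by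
  unfold sqrtAbs
  fun_prop

theorem measurable_sqrtMax {F : ℕ → G → ℝ} (hF : ∀ m, Measurable (F m)) (m : ℕ) :
    Measurable (sqrtMax F m) := by
  induction m with
  | zero => exact measurable_sqrtAbs.comp (hF 0)
  | succ m ih => exact ih.max (measurable_sqrtAbs.comp (hF (m + 1)))

theorem measurable_sqrtMaxIncr {F : ℕ → G → ℝ} (hF : ∀ m, Measurable (F m)) (m : ℕ) :
    Measurable (sqrtMaxIncr F m) :=
  (measurable_sqrtMax hF (m + 1)).sub (measurable_sqrtMax hF m)

theorem dependsOn_sqrtMax {F : ℕ → G → ℝ} (hF : ∀ m, DependsOn (F m) (Set.Iio m)) (m : ℕ) :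
    DependsOn (sqrtMax F m) (Set.Iio m) := by
  induction m with
  | zero =>
    intro x y h
    simp only [sqrtMax, hF 0 h]
  | succ m ih =>
    intro x y h
    simp only [sqrtMax, hF (m + 1) h, ih fun i hi => h i (Nat.lt_succ_of_lt hi)]

theorem coe_nnrealSqrt (a : ℝ≥0) : (NNReal.sqrt a : ℝ≥0∞) = (a : ℝ≥0∞) ^ (1 / 2 : ℝ) := by
  rw [NNReal.sqrt_eq_rpow, ENNReal.coe_rpow_of_nonneg _ (by norm_num)]

theorem sqrtMax_le (F : ℕ → G → ℝ) (m : ℕ) (x : G) :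
    (sqrtMax F m x : ℝ≥0∞) ≤ maximalFunction F x ^ (1 / 2 : ℝ) := by
  have h : ∀ m, (sqrtAbs (F m x) : ℝ≥0∞) ≤ maximalFunction F x ^ (1 / 2 : ℝ) := by
    intro m
    rw [sqrtAbs, coe_nnrealSqrt]
    exact ENNReal.rpow_le_rpow (le_iSup (fun n => ‖F n x‖ₑ) m) (by norm_num)
  induction m with
  | zero => exact h 0
  | succ m ih =>
    rw [sqrtMax, ENNReal.coe_max]
    exact max_le ih (h _)

/-! ### Iterated averages and their remainders -/

/-- The part of an iterated `L²`-average that is generated by the increments `a_N, …, a_{N+d-1}`. -/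
def remainder (a : ℕ → G → ℝ≥0) : ℕ → ℕ → G → ℝ≥0
  | 0, _, _ => 0
  | d + 1, N, x => ((invSqrtTwo ^ d * a N x + remainder a d (N + 1) x) +
      (invSqrtTwo ^ d * a N (flip N x) + remainder a d (N + 1) (flip N x))) / 2

theorem measurable_remainder {a : ℕ → G → ℝ≥0} (ha : ∀ m, Measurable (a m)) (d N : ℕ) :
    Measurable (remainder a d N) := by
  induction d generalizing N with
  | zero => exact measurable_const
  | succ d ih =>
    have h : Measurable fun x => invSqrtTwo ^ d * a N x + remainder a d (N + 1) x :=
      ((ha N).const_mul _).add (ih (N + 1))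
    exact (h.add (h.comp (measurable_flip N))).div_const 2

theorem lintegral_comp_flip (i : ℕ) {f : G → ℝ≥0∞} (hf : Measurable f) :
    ∫⁻ x, f (flip i x) ∂haarG = ∫⁻ x, f x ∂haarG :=
  (measurePreserving_flip i).lintegral_comp hf

/-- Flips preserve the measure, so averaging keeps integrals: each increment retains only the power
of `invSqrtTwo` with which it entered. -/
theorem lintegral_remainder {a : ℕ → G → ℝ≥0} (ha : ∀ m, Measurable (a m)) (d N : ℕ) :
    ∫⁻ x, remainder a d N x ∂haarG =
      ∑ m ∈ Finset.Ico N (N + d), (invSqrtTwo : ℝ≥0∞) ^ (N + d - 1 - m) * ∫⁻ x, a m x ∂haarG := by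
  induction d generalizing N with
  | zero => simp [remainder]
  | succ d ih =>
    set φ : G → ℝ≥0∞ := fun x => (invSqrtTwo : ℝ≥0∞) ^ d * a N x + remainder a d (N + 1) x with hφ
    have hm : Measurable φ :=
      ((ha N).coe_nnreal_ennreal.const_mul _).add (measurable_remainder ha d (N + 1)).coe_nnreal_ennreal
    have h1 : ∀ x, (remainder a (d + 1) N x : ℝ≥0∞) = (φ x + φ (flip N x)) * 2⁻¹ := by
      intro x
      simp only [remainder, hφ]
      rw [ENNReal.coe_div (by norm_num)]
      push_cast
      rfl
    simp_rw [h1]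
    have hm2 : Measurable fun x => φ x + φ (flip N x) := hm.add (hm.comp (measurable_flip N))
    rw [lintegral_mul_const _ hm2, lintegral_add_left hm,
      lintegral_comp_flip N hm, ← two_mul, mul_comm, ← mul_assoc,
      ENNReal.inv_mul_cancel (by norm_num) (by norm_num), one_mul,
      Finset.sum_eq_sum_Ico_succ_bot (by omega), hφ,
      lintegral_add_left ((ha N).coe_nnreal_ennreal.const_mul _),
      lintegral_const_mul _ (ha N).coe_nnreal_ennreal, ih, show N + (d + 1) - 1 - N = d by omega,
      show N + 1 + d = N + (d + 1) by omega]

/-- One averaging step: the common part `P` is contracted by `t`, while `r` and `r'` are merely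
averaged. After squaring, the cross term needs only `t ≥ 1/2`, and the surplus `r * r' / 2` is
nonnegative. -/
theorem le_of_sq_le_average {t P r r' u v L : ℝ} (ht : 1 ≤ 2 * t) (ht2 : t ^ 2 = 1 / 2)
    (hP : 0 ≤ P) (hr : 0 ≤ r) (hr' : 0 ≤ r') (hu0 : 0 ≤ u) (hv0 : 0 ≤ v) (hu : u ≤ P + r)
    (hv : v ≤ P + r') (hL : L ^ 2 ≤ (u ^ 2 + v ^ 2) / 4) : L ≤ t * P + (r + r') / 2 := by
  have ht0 : 0 ≤ t := by linarith
  refine le_of_pow_le_pow_left₀ two_ne_zero (by positivity) ?_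
  have h1 : u ^ 2 ≤ (P + r) ^ 2 := pow_le_pow_left₀ hu0 hu 2
  have h2 : v ^ 2 ≤ (P + r') ^ 2 := pow_le_pow_left₀ hv0 hv 2
  have h3 : (t * P + (r + r') / 2) ^ 2 =
      P ^ 2 / 2 + t * (P * (r + r')) + (r ^ 2 + r' ^ 2) / 4 + r * r' / 2 := by
    linear_combination P ^ 2 * ht2
  have h4 : (1 / 2) * (P * (r + r')) ≤ t * (P * (r + r')) :=
    mul_le_mul_of_nonneg_right (by linarith) (by positivity)
  have h5 : 0 ≤ r * r' := by positivity
  rw [h3]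
  nlinarith

/-- Downward induction from level `s + 1`. The maximum at level `N + 1` is the maximum at level `N`,
equal at `x` and `flip N x`, plus an increment that joins the remainder. -/
theorem sqrt_le_add_remainder {F : ℕ → G → ℝ} (hF : ∀ m, DependsOn (F m) (Set.Iio m))
    {h : ℕ → G → ℝ≥0} {s : ℕ}
    (h0 : ∀ x, NNReal.sqrt (h (s + 1) x) ≤ sqrtMax F (s + 1) x)
    (h1 : ∀ N ≤ s, ∀ x, h N x ≤ (h (N + 1) x + h (N + 1) (flip N x)) / 2) (d : ℕ) :
    ∀ N, N + d = s + 1 → ∀ x, invSqrtTwo ^ d * NNReal.sqrt (h N x) ≤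
      invSqrtTwo ^ d * sqrtMax F N x + remainder (sqrtMaxIncr F) d N x := by
  induction d with
  | zero =>
    rintro N hN x
    obtain rfl : N = s + 1 := hN
    simpa [remainder] using h0 x
  | succ d ih =>
    intro N hN x
    have hA := ih (N + 1) (by omega) x
    have hB := ih (N + 1) (by omega) (flip N x)
    rw [sqrtMax_succ, mul_add, add_assoc] at hA hB
    rw [dependsOn_flip le_rfl (dependsOn_sqrtMax hF N)] at hB
    have hsq : (invSqrtTwo ^ (d + 1) * NNReal.sqrt (h N x)) ^ 2 ≤
        ((invSqrtTwo ^ d * NNReal.sqrt (h (N + 1) x)) ^ 2 +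
          (invSqrtTwo ^ d * NNReal.sqrt (h (N + 1) (flip N x))) ^ 2) / 4 := by
      simp only [mul_pow, NNReal.sq_sqrt]
      calc (invSqrtTwo ^ (d + 1)) ^ 2 * h N x
          ≤ (invSqrtTwo ^ (d + 1)) ^ 2 * ((h (N + 1) x + h (N + 1) (flip N x)) / 2) := by
            gcongr
            exact h1 N (by omega) x
        _ = _ := by
            rw [pow_succ invSqrtTwo d, mul_pow, invSqrtTwo_sq]
            ring
    have := le_of_sq_le_average (t := invSqrtTwo) (by exact_mod_cast one_le_two_mul_invSqrtTwo)
      (by rw [← NNReal.coe_pow, invSqrtTwo_sq]; norm_num) (NNReal.coe_nonneg _)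
      (NNReal.coe_nonneg _) (NNReal.coe_nonneg _) (NNReal.coe_nonneg _) (NNReal.coe_nonneg _)
      (NNReal.coe_le_coe.mpr hA) (NNReal.coe_le_coe.mpr hB) (NNReal.coe_le_coe.mpr hsq)
    rw [← NNReal.coe_le_coe]
    refine this.trans_eq ?_
    simp only [remainder]
    push_cast
    ring

theorem sqrtAbs_walshPoly_le {F : ℕ → G → ℝ} (hF : Martingale F dyadicFiltration haarG)
    {s N : ℕ} (hN : N ≤ s) (x : G) :
    invSqrtTwo ^ (s - N) * sqrtAbs (walshPoly (shiftedCoeff F s) (2 ^ N) x) ≤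
      2 * (invSqrtTwo ^ (s - N) * sqrtMax F N x) +
        2 * remainder (sqrtMaxIncr F) (s - N + 1) N x := by
  -- The polynomials at levels up to `s` are continued by `F (s + 1)` on top. The extra level costs
  -- one factor `invSqrtTwo`, recovered from `1 ≤ 2 * invSqrtTwo`.
  set h : ℕ → G → ℝ≥0 := fun N x =>
    if N = s + 1 then ‖F (s + 1) x‖₊ else ‖walshPoly (shiftedCoeff F s) (2 ^ N) x‖₊ with hh
  have hd : ∀ m, DependsOn (F m) (Set.Iio m) := fun m =>
    dependsOn_of_stronglyMeasurable (hF.stronglyAdapted m)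
  have key := sqrt_le_add_remainder hd (h := h) (s := s)
    (fun x => by simpa [hh, sqrtAbs] using sqrtAbs_le_sqrtMax F (s + 1) x) (fun M hM x => by
      rw [← NNReal.coe_le_coe]
      rcases hM.lt_or_eq with hM' | rfl
      · simp only [hh, if_neg (show M ≠ s + 1 by omega), if_neg (show M + 1 ≠ s + 1 by omega)]
        rw [← coordAvg_walshPoly_two_pow, coordAvg]
        push_cast
        rw [norm_div, Real.norm_two]
        gcongr
        exact norm_add_le _ _
      · simp only [hh, if_neg (show M ≠ M + 1 by omega), if_true]
        push_cast
        exact abs_walshPoly_shiftedCoeff_le hF M x) (s - N + 1) N (by omega) x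
  simp only [hh, if_neg (show N ≠ s + 1 by omega)] at key
  calc _ ≤ (2 * invSqrtTwo) * (invSqrtTwo ^ (s - N) *
        sqrtAbs (walshPoly (shiftedCoeff F s) (2 ^ N) x)) :=
        le_mul_of_one_le_left zero_le one_le_two_mul_invSqrtTwo
    _ = 2 * (invSqrtTwo ^ (s - N + 1) * sqrtAbs (walshPoly (shiftedCoeff F s) (2 ^ N) x)) := by
        ring
    _ ≤ 2 * (invSqrtTwo ^ (s - N + 1) * sqrtMax F N x +
          remainder (sqrtMaxIncr F) (s - N + 1) N x) := by
        gcongr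
        exact key
    _ ≤ _ := by
        rw [mul_add]
        gcongr 2 * (?_ * _) + _
        exact pow_le_pow_of_le_one zero_le invSqrtTwo_lt_one.le (Nat.le_succ _)

/-! ### Pointwise bound by shifted sums -/

/-- The sum of the shifted increments that controls the averages of `sqrtMax F s`. -/
def shiftedMaxSum (F : ℕ → G → ℝ) (s : ℕ) (x : G) : ℝ≥0 :=
  ∑ j ∈ Finset.range s, invSqrtTwo ^ (s - j) * sqrtMax F s (flip j x)

/-- The sum of the shifted remainders that controls the oscillating part of the Fejér mean. -/
def shiftedRemainderSum (F : ℕ → G → ℝ) (s N : ℕ) (x : G) : ℝ≥0 :=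
  remainder (sqrtMaxIncr F) (s - N + 1) N x +
    ∑ j ∈ Finset.range N,
      invSqrtTwo ^ (N - j) * remainder (sqrtMaxIncr F) (s - N + 1) N (flip j x)

theorem sqrtAbs_fejerMean_le_shifted {F : ℕ → G → ℝ}
    (hF : Martingale F dyadicFiltration haarG)
    {s N m : ℕ} (hN : N ≤ s) (hm : m + 1 = 2 ^ N) (x : G) :
    sqrtAbs (fejerMean (2 ^ s + m) F x) ≤
      4 * sqrtMax F s x + 3 * shiftedMaxSum F s x + 2 * shiftedRemainderSum F s N x := by
  have hpow : ∀ n, invSqrtTwo ^ n ≤ 1 := fun n => pow_le_one₀ zero_le invSqrtTwo_lt_one.le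
  have h1 : ∑ j ∈ Finset.range s, invSqrtTwo ^ (s - j) * sqrtAbs (F s (flip j x)) ≤
      shiftedMaxSum F s x :=
    Finset.sum_le_sum fun j _ => by gcongr; exact sqrtAbs_le_sqrtMax _ _ _
  have h2 : invSqrtTwo ^ (s - N) * sqrtAbs (walshPoly (shiftedCoeff F s) (2 ^ N) x) ≤
      2 * sqrtMax F s x + 2 * remainder (sqrtMaxIncr F) (s - N + 1) N x := by
    refine (sqrtAbs_walshPoly_le hF hN x).trans ?_
    gcongr
    calc invSqrtTwo ^ (s - N) * sqrtMax F N x ≤ 1 * sqrtMax F s x := by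
          gcongr
          · exact hpow _
          · exact sqrtMax_mono F hN x
      _ = _ := one_mul _
  have h3 : ∑ j ∈ Finset.range N, invSqrtTwo ^ (s - j) *
      sqrtAbs (walshPoly (shiftedCoeff F s) (2 ^ N) (flip j x)) ≤
      2 * shiftedMaxSum F s x + 2 * ∑ j ∈ Finset.range N,
        invSqrtTwo ^ (N - j) * remainder (sqrtMaxIncr F) (s - N + 1) N (flip j x) := by
    have : ∀ j ∈ Finset.range N, invSqrtTwo ^ (s - j) *
        sqrtAbs (walshPoly (shiftedCoeff F s) (2 ^ N) (flip j x)) ≤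
        2 * (invSqrtTwo ^ (s - j) * sqrtMax F s (flip j x)) +
        2 * (invSqrtTwo ^ (N - j) * remainder (sqrtMaxIncr F) (s - N + 1) N (flip j x)) := by
      intro j hj
      have hj' := Finset.mem_range.mp hj
      -- One factor pays for the averaging down to level `N`; the other stays as geometric decay in
      -- `j`.
      have e : invSqrtTwo ^ (s - j) = invSqrtTwo ^ (N - j) * invSqrtTwo ^ (s - N) := by
        rw [← pow_add]
        congr 1
        omega
      rw [e, mul_assoc]
      refine (mul_le_mul_right (sqrtAbs_walshPoly_le hF hN (flip j x)) _).trans ?_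
      have := sqrtMax_mono F hN (flip j x)
      calc _ = 2 * (invSqrtTwo ^ (N - j) * invSqrtTwo ^ (s - N) * sqrtMax F N (flip j x)) +
            2 * (invSqrtTwo ^ (N - j) *
              remainder (sqrtMaxIncr F) (s - N + 1) N (flip j x)) := by ring
        _ ≤ _ := by gcongr
    refine (Finset.sum_le_sum this).trans ?_
    rw [Finset.sum_add_distrib, ← Finset.mul_sum, ← Finset.mul_sum]
    gcongr
    exact Finset.sum_le_sum_of_subset (Finset.range_mono hN)
  refine (sqrtAbs_fejerMean_le hF hN hm x).trans ?_
  calc _ ≤ 2 * sqrtMax F s x + shiftedMaxSum F s x + ((2 * sqrtMax F s x +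
        2 * remainder (sqrtMaxIncr F) (s - N + 1) N x) + (2 * shiftedMaxSum F s x +
        2 * ∑ j ∈ Finset.range N,
          invSqrtTwo ^ (N - j) * remainder (sqrtMaxIncr F) (s - N + 1) N (flip j x))) := by
        gcongr
        exact sqrtAbs_le_sqrtMax _ _ _
    _ = _ := by
        rw [shiftedRemainderSum]
        ring

/-! ### Geometric sums and integral estimates -/

/-- The sum of the geometric series with ratio `2 ^ (-1/2)`. -/
def geomConst : ℝ≥0∞ := (1 - (invSqrtTwo : ℝ≥0∞))⁻¹

theorem geomConst_ne_top : geomConst ≠ ∞ := by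
  rw [geomConst, ENNReal.inv_ne_top]
  exact (tsub_pos_of_lt (by exact_mod_cast invSqrtTwo_lt_one)).ne'

theorem tsum_invSqrtTwo_pow : ∑' n : ℕ, (invSqrtTwo : ℝ≥0∞) ^ n = geomConst :=
  ENNReal.tsum_geometric _

theorem sum_invSqrtTwo_pow_le {S : Finset ℕ} {f : ℕ → ℕ} (hf : Set.InjOn f S) :
    ∑ j ∈ S, (invSqrtTwo : ℝ≥0∞) ^ f j ≤ geomConst := by
  rw [← Finset.sum_image (f := fun n => (invSqrtTwo : ℝ≥0∞) ^ n) hf, ← tsum_invSqrtTwo_pow]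
  exact ENNReal.sum_le_tsum _

theorem sum_invSqrtTwo_pow_sub_le (n M : ℕ) (h : n ≤ M + 1) :
    ∑ j ∈ Finset.range n, (invSqrtTwo : ℝ≥0∞) ^ (M - j) ≤ geomConst := by
  refine sum_invSqrtTwo_pow_le fun a ha b hb hab => ?_
  have ha' : a < n := by simpa using ha
  have hb' : b < n := by simpa using hb
  omega

theorem tsum_sum_range_invSqrtTwo_le (A : ℕ → ℝ≥0∞) :
    ∑' s : ℕ, ∑ m ∈ Finset.range (s + 1), (invSqrtTwo : ℝ≥0∞) ^ (s - m) * A m ≤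
      geomConst * ∑' m, A m := by
  have h1 : ∀ s, ∑ m ∈ Finset.range (s + 1), (invSqrtTwo : ℝ≥0∞) ^ (s - m) * A m =
      ∑' m, if m ≤ s then (invSqrtTwo : ℝ≥0∞) ^ (s - m) * A m else 0 := by
    intro s
    rw [tsum_eq_sum (s := Finset.range (s + 1)) fun m hm => if_neg (by simpa using hm)]
    exact Finset.sum_congr rfl fun m hm =>
      (if_pos (Nat.lt_succ_iff.mp (Finset.mem_range.mp hm))).symm
  simp_rw [h1]
  rw [ENNReal.tsum_comm, ← ENNReal.tsum_mul_left]
  refine ENNReal.tsum_le_tsum fun m => ENNReal.tsum_le_of_sum_range_le fun n => ?_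
  rw [← Finset.sum_filter, ← Finset.sum_mul]
  gcongr
  refine sum_invSqrtTwo_pow_le fun a ha b hb hab => ?_
  have ha' : m ≤ a := by simpa using (Finset.mem_filter.mp ha).2
  have hb' : m ≤ b := by simpa using (Finset.mem_filter.mp hb).2
  omega

/-- A majorant of the shifted increments in `shiftedMaxSum`, uniform in `s`. -/
def shiftedIncrSum (F : ℕ → G → ℝ) (x : G) : ℝ≥0∞ :=
  ∑' m : ℕ, ∑' u : ℕ, ∑ j ∈ Finset.range (m + 1),
    (invSqrtTwo : ℝ≥0∞) ^ u * ((invSqrtTwo : ℝ≥0∞) ^ (m - j) * sqrtMaxIncr F m (flip j x))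

/-- The maximum up to time `j` is invariant under `flip j`, so only increments with `m ≥ j` are
translated. -/
theorem shiftedMaxSum_le {F : ℕ → G → ℝ} (hF : ∀ m, DependsOn (F m) (Set.Iio m)) (s : ℕ) (x : G) :
    (shiftedMaxSum F s x : ℝ≥0∞) ≤
      geomConst * maximalFunction F x ^ (1 / 2 : ℝ) + shiftedIncrSum F x := by
  have h1 : shiftedMaxSum F s x =
      ∑ j ∈ Finset.range s, invSqrtTwo ^ (s - j) * sqrtMax F j x +
      ∑ j ∈ Finset.range s, ∑ m ∈ Finset.Ico j s,
        invSqrtTwo ^ (s - j) * sqrtMaxIncr F m (flip j x) := by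
    rw [shiftedMaxSum, ← Finset.sum_add_distrib]
    refine Finset.sum_congr rfl fun j hj => ?_
    rw [sqrtMax_eq_add_sum F (Finset.mem_range.mp hj).le,
      dependsOn_flip le_rfl (dependsOn_sqrtMax hF j), mul_add, Finset.mul_sum]
  have h2 : ∑ j ∈ Finset.range s, ∑ m ∈ Finset.Ico j s,
        invSqrtTwo ^ (s - j) * sqrtMaxIncr F m (flip j x) =
      ∑ m ∈ Finset.range s, ∑ j ∈ Finset.range (m + 1),
        invSqrtTwo ^ (s - j) * sqrtMaxIncr F m (flip j x) :=
    Finset.sum_comm' fun j m => by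
      simp only [Finset.mem_range, Finset.mem_Ico]
      omega
  rw [h1, h2, ENNReal.coe_add]
  push_cast
  refine add_le_add ?_ ?_
  · calc _ ≤ ∑ j ∈ Finset.range s, (invSqrtTwo : ℝ≥0∞) ^ (s - j) *
          maximalFunction F x ^ (1 / 2 : ℝ) :=
          Finset.sum_le_sum fun j _ => by gcongr; exact sqrtMax_le F j x
      _ ≤ _ := by
          rw [← Finset.sum_mul]
          gcongr
          exact sum_invSqrtTwo_pow_sub_le s s (Nat.le_succ s)
  · refine le_trans (Finset.sum_le_sum fun m hm => ?_) (ENNReal.sum_le_tsum (Finset.range s))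
    have hm' := Finset.mem_range.mp hm
    -- The choice `u = s - m` factors the weight; summing over all `u` makes the majorant
    -- independent of `s`.
    refine le_trans (Finset.sum_le_sum fun j hj => ?_) (ENNReal.le_tsum (s - m))
    have hj' := Finset.mem_range.mp hj
    rw [← mul_assoc, ← pow_add, show s - m + (m - j) = s - j by omega]

theorem lintegral_shiftedIncrSum_le {F : ℕ → G → ℝ} (hF : ∀ m, Measurable (F m)) :
    ∫⁻ x, shiftedIncrSum F x ∂haarG ≤
      geomConst * geomConst * ∑' m, ∫⁻ x, sqrtMaxIncr F m x ∂haarG := by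
  have hm : ∀ m, Measurable fun x => (sqrtMaxIncr F m x : ℝ≥0∞) := fun m =>
    (measurable_sqrtMaxIncr hF m).coe_nnreal_ennreal
  have hm1 : ∀ m u j : ℕ, Measurable fun x => (invSqrtTwo : ℝ≥0∞) ^ u *
      ((invSqrtTwo : ℝ≥0∞) ^ (m - j) * sqrtMaxIncr F m (flip j x)) := fun m u j =>
    (((hm m).comp (measurable_flip j)).const_mul _).const_mul _
  have hm2 : ∀ m u : ℕ, Measurable fun x => ∑ j ∈ Finset.range (m + 1), (invSqrtTwo : ℝ≥0∞) ^ u *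
      ((invSqrtTwo : ℝ≥0∞) ^ (m - j) * sqrtMaxIncr F m (flip j x)) := fun m u =>
    Finset.measurable_fun_sum _ fun j _ => hm1 m u j
  simp only [shiftedIncrSum]
  rw [lintegral_tsum fun m => (Measurable.tsum fun u => hm2 m u).aemeasurable,
    ← ENNReal.tsum_mul_left]
  refine ENNReal.tsum_le_tsum fun m => ?_
  rw [lintegral_tsum fun u => (hm2 m u).aemeasurable, mul_assoc, ← tsum_invSqrtTwo_pow,
    ← ENNReal.tsum_mul_right, tsum_invSqrtTwo_pow]
  refine ENNReal.tsum_le_tsum fun u => ?_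
  rw [lintegral_finsetSum _ fun j _ => hm1 m u j]
  calc _ = ∑ j ∈ Finset.range (m + 1), (invSqrtTwo : ℝ≥0∞) ^ u *
        ((invSqrtTwo : ℝ≥0∞) ^ (m - j) * ∫⁻ x, sqrtMaxIncr F m x ∂haarG) := by
        refine Finset.sum_congr rfl fun j _ => ?_
        have hj : Measurable fun x => (sqrtMaxIncr F m (flip j x) : ℝ≥0∞) :=
          (hm m).comp (measurable_flip j)
        rw [lintegral_const_mul _ (hj.const_mul _), lintegral_const_mul _ hj,
          ← lintegral_comp_flip j (hm m)]
    _ ≤ _ := by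
        rw [← Finset.mul_sum, ← Finset.sum_mul]
        gcongr
        exact sum_invSqrtTwo_pow_sub_le (m + 1) m le_rfl

/-- The bound does not depend on `N`, so averaging over `N` loses nothing. -/
theorem lintegral_shiftedRemainderSum_le {F : ℕ → G → ℝ} (hF : ∀ m, Measurable (F m)) {s N : ℕ}
    (hN : N ≤ s) : ∫⁻ x, shiftedRemainderSum F s N x ∂haarG ≤ (1 + geomConst) *
      ∑ m ∈ Finset.range (s + 1),
        (invSqrtTwo : ℝ≥0∞) ^ (s - m) * ∫⁻ x, sqrtMaxIncr F m x ∂haarG := by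
  set ρ : G → ℝ≥0∞ := fun x => remainder (sqrtMaxIncr F) (s - N + 1) N x with hρ
  have hm : Measurable ρ :=
    (measurable_remainder (measurable_sqrtMaxIncr hF) _ _).coe_nnreal_ennreal
  have hI : ∫⁻ x, ρ x ∂haarG ≤ ∑ m ∈ Finset.range (s + 1),
      (invSqrtTwo : ℝ≥0∞) ^ (s - m) * ∫⁻ x, sqrtMaxIncr F m x ∂haarG := by
    rw [hρ, lintegral_remainder (measurable_sqrtMaxIncr hF), show N + (s - N + 1) = s + 1 by omega,
      Nat.add_sub_cancel]
    refine Finset.sum_le_sum_of_subset fun m hm => ?_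
    simp only [Finset.mem_Ico, Finset.mem_range] at hm ⊢
    exact hm.2
  have h1 : ∀ x, (shiftedRemainderSum F s N x : ℝ≥0∞) =
      ρ x + ∑ j ∈ Finset.range N, (invSqrtTwo : ℝ≥0∞) ^ (N - j) * ρ (flip j x) := by
    intro x
    rw [shiftedRemainderSum]
    push_cast
    rfl
  have hmj : ∀ j, Measurable fun x => ρ (flip j x) := fun j => hm.comp (measurable_flip j)
  simp_rw [h1]
  rw [lintegral_add_left hm, lintegral_finsetSum _ fun j _ => (hmj j).const_mul _]
  have h2 : ∀ j, ∫⁻ x, (invSqrtTwo : ℝ≥0∞) ^ (N - j) * ρ (flip j x) ∂haarG =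
      (invSqrtTwo : ℝ≥0∞) ^ (N - j) * ∫⁻ x, ρ x ∂haarG := by
    intro j
    rw [lintegral_const_mul _ (hmj j), lintegral_comp_flip j hm]
  simp_rw [h2]
  rw [← Finset.sum_mul]
  calc _ ≤ ∫⁻ x, ρ x ∂haarG + geomConst * ∫⁻ x, ρ x ∂haarG := by
        gcongr
        exact sum_invSqrtTwo_pow_sub_le N N (Nat.le_succ N)
    _ = (1 + geomConst) * ∫⁻ x, ρ x ∂haarG := by ring
    _ ≤ _ := by gcongr

/-- The weighted sum of all remainders with `1 ≤ N ≤ K s`. -/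
def weightedRemainderSum (K : ℕ → ℕ) (F : ℕ → G → ℝ) (x : G) : ℝ≥0∞ :=
  ∑' s : ℕ, ∑ N ∈ Finset.Icc 1 (K s), (K s : ℝ≥0∞)⁻¹ * shiftedRemainderSum F s N x

theorem measurable_shiftedRemainderSum {F : ℕ → G → ℝ} (hF : ∀ m, Measurable (F m)) (s N : ℕ) :
    Measurable (shiftedRemainderSum F s N) := by
  have h := measurable_remainder (measurable_sqrtMaxIncr hF) (s - N + 1) N
  exact h.add (Finset.measurable_fun_sum _ fun j _ => (h.comp (measurable_flip j)).const_mul _)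

theorem lintegral_weightedRemainderSum_le {F : ℕ → G → ℝ} (hF : ∀ m, Measurable (F m))
    {K : ℕ → ℕ} (hK : ∀ s, K s ≤ s) :
    ∫⁻ x, weightedRemainderSum K F x ∂haarG ≤
      (1 + geomConst) * (geomConst * ∑' m, ∫⁻ x, sqrtMaxIncr F m x ∂haarG) := by
  have hm : ∀ s N, Measurable fun x => (K s : ℝ≥0∞)⁻¹ * (shiftedRemainderSum F s N x : ℝ≥0∞) :=
    fun s N => (measurable_shiftedRemainderSum hF s N).coe_nnreal_ennreal.const_mul _
  simp only [weightedRemainderSum]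
  rw [lintegral_tsum fun s => (Finset.measurable_fun_sum _ fun N _ => hm s N).aemeasurable]
  refine le_trans (ENNReal.tsum_le_tsum fun s => ?_) (le_trans (ENNReal.tsum_mul_left
    (a := 1 + geomConst)).le (by gcongr; exact tsum_sum_range_invSqrtTwo_le _))
  rw [lintegral_finsetSum _ fun N _ => hm s N]
  calc _ ≤ ∑ N ∈ Finset.Icc 1 (K s), (K s : ℝ≥0∞)⁻¹ * ((1 + geomConst) *
        ∑ m ∈ Finset.range (s + 1),
          (invSqrtTwo : ℝ≥0∞) ^ (s - m) * ∫⁻ x, sqrtMaxIncr F m x ∂haarG) := by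
        refine Finset.sum_le_sum fun N hN => ?_
        rw [lintegral_const_mul _ (measurable_shiftedRemainderSum hF s N).coe_nnreal_ennreal]
        gcongr
        exact lintegral_shiftedRemainderSum_le hF ((Finset.mem_Icc.mp hN).2.trans (hK s))
    _ = ((K s : ℝ≥0∞) * (K s : ℝ≥0∞)⁻¹) * _ := by
        rw [Finset.sum_const, Nat.card_Icc, Nat.add_sub_cancel, nsmul_eq_mul, mul_assoc]
    -- This also covers `K s = 0`, where the product is `0 * ∞ = 0`.
    _ ≤ _ := mul_le_of_le_one_left zero_le (ENNReal.mul_inv_le_one _)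

/-- The increments telescope to the running maximum. -/
theorem tsum_lintegral_sqrtMaxIncr_le {F : ℕ → G → ℝ} (hF : ∀ m, Measurable (F m)) :
    ∑' m, ∫⁻ x, sqrtMaxIncr F m x ∂haarG ≤ ∫⁻ x, maximalFunction F x ^ (1 / 2 : ℝ) ∂haarG := by
  rw [← lintegral_tsum fun m => (measurable_sqrtMaxIncr hF m).coe_nnreal_ennreal.aemeasurable]
  refine lintegral_mono fun x => ENNReal.tsum_le_of_sum_range_le fun n => ?_
  refine le_trans ?_ (sqrtMax_le F n x)
  rw [sqrtMax_eq_add_sum F (Nat.zero_le n), Finset.range_eq_Ico]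
  exact_mod_cast le_add_self

/-! ### The logarithmic weight and the final majorant -/

theorem alpha_eq (s k : ℕ) : alpha s k = 2 ^ s + (2 ^ (k + 1) - 1) := by
  rw [alpha, Nat.geomSum_eq le_rfl]
  simp

/-- The bound `[s ^ (1/n)]` of the second index of the restricted maximal operator. -/
def rootFloor (n s : ℕ) : ℕ := ⌊(s : ℝ) ^ (1 / (n : ℝ))⌋₊

theorem rootFloor_le {n : ℕ} (hn : 1 ≤ n) (s : ℕ) : rootFloor n s ≤ s := by
  have hn' : (1 : ℝ) ≤ n := by exact_mod_cast hn
  rcases Nat.eq_zero_or_pos s with rfl | hs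
  · rw [rootFloor, Nat.cast_zero, Real.zero_rpow (by positivity)]
    simp
  · refine Nat.floor_le_of_le ?_
    have hs' : (1 : ℝ) ≤ s := by exact_mod_cast hs
    calc (s : ℝ) ^ (1 / (n : ℝ)) ≤ (s : ℝ) ^ (1 : ℝ) :=
          Real.rpow_le_rpow_of_exponent_le hs' ((div_le_one (by positivity)).mpr hn')
      _ = s := Real.rpow_one _

theorem one_le_log_alpha {s k : ℕ} (hs : 1 ≤ s) : 1 ≤ Real.log (alpha s k) := by
  have h2 : 2 ^ 1 ≤ 2 ^ s := Nat.pow_le_pow_right (by norm_num) hs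
  have h3 : 2 ^ 1 ≤ 2 ^ (k + 1) := Nat.pow_le_pow_right (by norm_num) (by omega)
  have h : 3 ≤ alpha s k := by rw [alpha_eq]; omega
  have h' : (3 : ℝ) ≤ alpha s k := by exact_mod_cast h
  rw [Real.le_log_iff_exp_le (by linarith)]
  linarith [Real.exp_one_lt_d9]

/-- Since `log 2 ≥ 1/2`, the logarithm is at least `s / 2`, and `(1/2) ^ (1/n) ≥ 1/2` because `n ≥
1`. -/
theorem half_rootFloor_le {n s k : ℕ} (hn : 1 ≤ n) (hs : 1 ≤ s) :
    (rootFloor n s : ℝ) / 2 ≤ Real.log (alpha s k) ^ (1 / (n : ℝ)) := by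
  have hn' : (1 : ℝ) ≤ n := by exact_mod_cast hn
  have hpow : (2 : ℝ) ^ s ≤ alpha s k := by
    rw [alpha_eq]
    exact_mod_cast Nat.le_add_right _ _
  have hlog : (s : ℝ) * (1 / 2) ≤ Real.log (alpha s k) := by
    calc (s : ℝ) * (1 / 2) ≤ s * Real.log 2 := by
          gcongr
          linarith [Real.log_two_gt_d9]
      _ = Real.log (2 ^ s) := (Real.log_pow _ _).symm
      _ ≤ _ := Real.log_le_log (by positivity) hpow
  calc (rootFloor n s : ℝ) / 2 ≤ (s : ℝ) ^ (1 / (n : ℝ)) * (1 / 2) := by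
        rw [div_eq_mul_one_div]
        gcongr
        exact Nat.floor_le (by positivity)
    _ ≤ (s : ℝ) ^ (1 / (n : ℝ)) * (1 / 2) ^ (1 / (n : ℝ)) := by
        gcongr
        conv_lhs => rw [← Real.rpow_one (1 / 2)]
        exact Real.rpow_le_rpow_of_exponent_ge (by norm_num) (by norm_num)
          ((div_le_one (by positivity)).mpr hn')
    _ = ((s : ℝ) * (1 / 2)) ^ (1 / (n : ℝ)) :=
        (Real.mul_rpow (by positivity) (by norm_num)).symm
    _ ≤ _ := Real.rpow_le_rpow (by positivity) hlog (by positivity)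

/-- The majorant of the square root of the restricted maximal operator. -/
def majorant (n : ℕ) (F : ℕ → G → ℝ) (x : G) : ℝ≥0∞ :=
  (4 + 3 * geomConst) * maximalFunction F x ^ (1 / 2 : ℝ) + 3 * shiftedIncrSum F x +
    4 * weightedRemainderSum (rootFloor n) F x

/-- The weight serves twice: `1 ≤ L` lets it be dropped from `T`, and `K / 2 ≤ L` turns it into the
factor `K⁻¹` on `W`. -/
theorem div_le_of_weight {σ T W L K : ℝ≥0} (h : σ ≤ T + 2 * W) (hL : 1 ≤ L) (hK : K / 2 ≤ L)
    (hK0 : K ≠ 0) : σ / L ≤ T + 4 * (K⁻¹ * W) := by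
  have hL0 : 0 < L := zero_lt_one.trans_le hL
  rw [div_le_iff₀ hL0]
  refine h.trans ?_
  rw [add_mul]
  refine add_le_add (le_mul_of_one_le_right zero_le hL) ?_
  calc 2 * W = 4 * (K⁻¹ * W) * (K / 2) := by field_simp; ring
    _ ≤ _ := by gcongr

theorem sqrt_term_le_majorant {n : ℕ} (hn : 1 ≤ n) {F : ℕ → G → ℝ}
    (hF : Martingale F dyadicFiltration haarG) {s k : ℕ} (hk : k < rootFloor n s) (x : G) :
    ENNReal.ofReal (|fejerMean (alpha s k) F x| / Real.log (alpha s k) ^ (2 / (n : ℝ))) ^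
      (1 / 2 : ℝ) ≤ majorant n F x := by
  have hKs := rootFloor_le hn s
  have hs : 1 ≤ s := by omega
  have hlog := one_le_log_alpha (k := k) hs
  have hlog0 : 0 ≤ Real.log (alpha s k) := by linarith
  obtain ⟨L, hLdef⟩ : ∃ L : ℝ≥0, (L : ℝ) = Real.log (alpha s k) ^ (1 / (n : ℝ)) :=
    ⟨⟨Real.log (alpha s k) ^ (1 / (n : ℝ)), by positivity⟩, rfl⟩
  have hL2 : Real.log (alpha s k) ^ (2 / (n : ℝ)) = (L ^ 2 : ℝ≥0) := by
    rw [NNReal.coe_pow, hLdef, ← Real.rpow_natCast, ← Real.rpow_mul hlog0]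
    congr 1
    push_cast
    ring
  have hL1 : 1 ≤ L := by
    rw [← NNReal.coe_le_coe, hLdef]
    exact Real.one_le_rpow hlog (by positivity)
  have hterm : ENNReal.ofReal (|fejerMean (alpha s k) F x| /
      Real.log (alpha s k) ^ (2 / (n : ℝ))) ^ (1 / 2 : ℝ) =
      ((sqrtAbs (fejerMean (alpha s k) F x) / L : ℝ≥0) : ℝ≥0∞) := by
    have e : |fejerMean (alpha s k) F x| / Real.log (alpha s k) ^ (2 / (n : ℝ)) =
        ((‖fejerMean (alpha s k) F x‖₊ / L ^ 2 : ℝ≥0) : ℝ) := by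
      rw [NNReal.coe_div, hL2, coe_nnnorm, Real.norm_eq_abs]
    rw [e, ENNReal.ofReal_coe_nnreal, ← coe_nnrealSqrt, NNReal.sqrt_div, NNReal.sqrt_sq]
    rfl
  -- The condition on `k` gives `k + 1 ≤ rootFloor n s ≤ s`, so `N = k + 1` is admissible.
  have hbound := sqrtAbs_fejerMean_le_shifted hF (N := k + 1) (m := 2 ^ (k + 1) - 1) (s := s)
    (by omega) (Nat.sub_add_cancel Nat.one_le_two_pow) x
  rw [← alpha_eq] at hbound
  have hdiv := div_le_of_weight (K := rootFloor n s) hbound hL1 (by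
    rw [← NNReal.coe_le_coe]
    push_cast
    rw [hLdef]
    exact half_rootFloor_le hn hs) (by exact_mod_cast (by omega : rootFloor n s ≠ 0))
  rw [hterm]
  refine (ENNReal.coe_le_coe.mpr hdiv).trans ?_
  have hd : ∀ m, DependsOn (F m) (Set.Iio m) := fun m =>
    dependsOn_of_stronglyMeasurable (hF.stronglyAdapted m)
  have hW : ((rootFloor n s : ℝ≥0∞))⁻¹ * shiftedRemainderSum F s (k + 1) x ≤
      weightedRemainderSum (rootFloor n) F x := by
    refine le_trans ?_ (ENNReal.le_tsum s)
    exact Finset.single_le_sum (f := fun N => ((rootFloor n s : ℝ≥0∞))⁻¹ *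
      (shiftedRemainderSum F s N x : ℝ≥0∞)) (fun _ _ => zero_le)
      (Finset.mem_Icc.mpr ⟨by omega, by omega⟩)
  push_cast
  rw [ENNReal.coe_inv (by exact_mod_cast (by omega : rootFloor n s ≠ 0)), ENNReal.coe_natCast,
    majorant]
  calc _ ≤ 4 * maximalFunction F x ^ (1 / 2 : ℝ) +
        3 * (geomConst * maximalFunction F x ^ (1 / 2 : ℝ) + shiftedIncrSum F x) +
        4 * weightedRemainderSum (rootFloor n) F x := by
        gcongr
        · exact sqrtMax_le F s x
        · exact shiftedMaxSum_le hd s x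
    _ = _ := by ring

theorem restrictedMaximal_rpow_le {n : ℕ} (hn : 1 ≤ n) {F : ℕ → G → ℝ}
    (hF : Martingale F dyadicFiltration haarG) (x : G) :
    restrictedMaximal n F x ^ (1 / 2 : ℝ) ≤ majorant n F x := by
  have h : restrictedMaximal n F x ≤ majorant n F x ^ (2 : ℝ) := by
    refine iSup_le fun s => iSup_le fun k => iSup_le fun hk => ?_
    have := ENNReal.rpow_le_rpow (sqrt_term_le_majorant hn hF hk x) (by norm_num : (0 : ℝ) ≤ 2)
    rwa [← ENNReal.rpow_mul, show (1 / 2 : ℝ) * 2 = 1 by norm_num, ENNReal.rpow_one] at this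
  have := ENNReal.rpow_le_rpow h (by norm_num : (0 : ℝ) ≤ 1 / 2)
  rwa [← ENNReal.rpow_mul, show (2 : ℝ) * (1 / 2) = 1 by norm_num, ENNReal.rpow_one] at this

theorem measurable_maximalFunction {F : ℕ → G → ℝ} (hF : ∀ m, Measurable (F m)) :
    Measurable (maximalFunction F) :=
  Measurable.iSup fun n => (hF n).enorm

theorem measurable_shiftedIncrSum {F : ℕ → G → ℝ} (hF : ∀ m, Measurable (F m)) :
    Measurable (shiftedIncrSum F) :=
  Measurable.tsum fun m => Measurable.tsum fun _ =>
    Finset.measurable_fun_sum _ fun j _ =>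
      (((measurable_sqrtMaxIncr hF m).comp (measurable_flip j)).coe_nnreal_ennreal.const_mul
        _).const_mul _

theorem measurable_restrictedMaximal (n : ℕ) (F : ℕ → G → ℝ) :
    Measurable (restrictedMaximal n F) := by
  have h : ∀ j, Measurable (fejerMean j F) := fun j =>
    (Finset.measurable_fun_sum _ fun i _ => Finset.measurable_fun_sum _ fun k _ =>
      (measurable_walsh k).const_mul _).const_mul _
  refine Measurable.iSup fun s => Measurable.iSup fun k => Measurable.iSup fun _ => ?_
  exact (((h _).abs).div_const _).ennreal_ofReal

/-- The constant bounding the integral of the majorant. -/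
def majorantConst : ℝ≥0∞ :=
  (4 + 3 * geomConst) + 3 * (geomConst * geomConst) + 4 * ((1 + geomConst) * geomConst)

theorem majorantConst_ne_top : majorantConst ≠ ∞ := by
  have h := geomConst_ne_top
  unfold majorantConst
  finiteness

theorem lintegral_majorant_le {n : ℕ} (hn : 1 ≤ n) {F : ℕ → G → ℝ} (hF : ∀ m, Measurable (F m)) :
    ∫⁻ x, majorant n F x ∂haarG ≤
      majorantConst * ∫⁻ x, maximalFunction F x ^ (1 / 2 : ℝ) ∂haarG := by
  have hm1 : Measurable fun x => maximalFunction F x ^ (1 / 2 : ℝ) :=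
    (measurable_maximalFunction hF).pow_const _
  have hm2 := measurable_shiftedIncrSum hF
  have hsum := tsum_lintegral_sqrtMaxIncr_le hF
  simp only [majorant]
  have hm3 : Measurable fun x => (4 + 3 * geomConst) * maximalFunction F x ^ (1 / 2 : ℝ) +
      3 * shiftedIncrSum F x := (hm1.const_mul _).add (hm2.const_mul _)
  -- The remainder sum is the right summand, so its measurability is not needed.
  rw [lintegral_add_left hm3,
    lintegral_add_left (hm1.const_mul _), lintegral_const_mul _ hm1, lintegral_const_mul _ hm2,
    lintegral_const_mul' _ _ (by norm_num)]
  set I := ∫⁻ x, maximalFunction F x ^ (1 / 2 : ℝ) ∂haarG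
  calc _ ≤ (4 + 3 * geomConst) * I + 3 * (geomConst * geomConst * I) +
        4 * ((1 + geomConst) * (geomConst * I)) := by
        gcongr
        · exact (lintegral_shiftedIncrSum_le hF).trans (by gcongr)
        · exact (lintegral_weightedRemainderSum_le hF (rootFloor_le hn)).trans (by gcongr)
    _ = _ := by
        rw [majorantConst]
        ring

theorem eLpNorm_half (f : G → ℝ≥0∞) :
    eLpNorm f (1 / 2) haarG = (∫⁻ x, f x ^ (1 / 2 : ℝ) ∂haarG) ^ (2 : ℝ) := by
  have h : (1 / 2 : ℝ≥0∞).toReal = 1 / 2 := by simp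
  rw [eLpNorm_eq_lintegral_rpow_enorm_toReal (by simp) (by simp), h]
  norm_num

theorem eLpNorm_restrictedMaximal_le {n : ℕ} (hn : 1 ≤ n) {F : ℕ → G → ℝ}
    (hF : Martingale F dyadicFiltration haarG) :
    eLpNorm (restrictedMaximal n F) (1 / 2) haarG ≤
      majorantConst ^ (2 : ℝ) * hardyNorm (1 / 2) F := by
  have hm : ∀ m, Measurable (F m) := fun m =>
    ((hF.stronglyAdapted m).mono (dyadicFiltration.le m)).measurable
  rw [hardyNorm, eLpNorm_half, eLpNorm_half, ← ENNReal.mul_rpow_of_nonneg _ _ (by norm_num)]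
  refine ENNReal.rpow_le_rpow ?_ (by norm_num)
  exact (lintegral_mono fun x => restrictedMaximal_rpow_le hn hF x).trans
    (lintegral_majorant_le hn hm)

end WalshFejer

end

theorem corollary5 (n : ℕ) (hn : 1 ≤ n) :
    ∃ c : ℝ≥0, ∀ F : ℕ → WalshFejer.G → ℝ, WalshFejer.MemHardy (1 / 2) F →
      MemLp (WalshFejer.restrictedMaximal n F) (1 / 2) WalshFejer.haarG ∧
      eLpNorm (WalshFejer.restrictedMaximal n F) (1 / 2) WalshFejer.haarG
        ≤ c * WalshFejer.hardyNorm (1 / 2) F := by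
  have hc : WalshFejer.majorantConst ^ (2 : ℝ) ≠ ∞ :=
    ENNReal.rpow_ne_top_of_nonneg (by norm_num) WalshFejer.majorantConst_ne_top
  -- The constant is squared because the quasi-norm is the square of the integral of the root.
  refine ⟨(WalshFejer.majorantConst ^ (2 : ℝ)).toNNReal, fun F hF => ?_⟩
  have h := WalshFejer.eLpNorm_restrictedMaximal_le hn hF.1
  rw [ENNReal.coe_toNNReal hc]
  exact ⟨⟨(WalshFejer.measurable_restrictedMaximal n F).aestronglyMeasurable,
    h.trans_lt (ENNReal.mul_lt_top hc.lt_top hF.2)⟩, h⟩
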